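/- Let $n\ge 1$, $d\ge 0$, $k\ge 0$ be integers and let $\mathcal H_A=\bigotimes_{i=1}^n\mathcal H_{A_i}$, $\mathcal H_B=\bigotimes_{i=1}^n\mathcal H_{B_i}$ with $\mathcal H_{A_i}=\mathcal H_{B_i}=\mathbb C^d$. Let $|\Omega_j\rangle=\sum_{s=1}^d|s\rangle\otimes|s\rangle\in\mathcal H_{A_j}\otimes\mathcal H_{B_j}$ and $|\Omega\rangle=\bigotimes_{j=1}^n|\Omega_j\rangle\in\mathcal H_A\otimes\mathcal H_B$ (unnormalized). For $1\le i\le n$ let $\omega_{(i)}=\mathbb 1\otimes\bigotimes_{j\neq i}|\Omega_j\rangle\langle\Omega_j|$ on $\mathcal H_A\otimes\mathcal H_B$, where the identity acts on $\mathcal H_{A_i}\otimes\mathcal H_{B_i}$, and put $$W_k=\bigl(1+(n-1)k\bigr)\mathbb 1-\sum_{i=1}^n\omega_{(i)} .$$ The Schmidt rank of $\psi\in\mathcal H_A\otimes\mathcal H_B$ is the rank of the partial trace $\mathrm{tr}_B|\psi\rangle\langle\psi|$. A Hermitian operator $W$ on $\mathcal H_A\otimes\mathcal H_B$ is a Schmidt-number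 witness of class $k+1$ if $\langle\psi,W\psi\rangle\ge 0$ for all $\psi$ of Schmidt rank at most $k$ and $\langle\varphi,W\varphi\rangle<0$ for at least one $\varphi$ of Schmidt rank $k+1$. A linear map $T$ between matrix spaces is $k$-positive if $T\otimes\mathrm{id}_k$, with $\mathrm{id}_k$ the identity map on $k\times k$ matrices, maps positive semidefinite matrices to positive semidefinite matrices. Then: 1. If $n\ge 2$ and $0\le k<d$, then $W_k$ is a Schmidt-number witness of class $k+1$. 2. For all $n\ge 1$, $d\ge0$ and $k\ge 0$, $\langle\psi,W_k\psi\rangle\ge 0$ for every $\psi$ of Schmidt rank at most $k$. 3. For all $n\ge 1$, $d\ge0$ and $k\ge 0$, let $T$ be the linear map on $(\mathcal M_d)^{\otimes n}$ (with $\mathcal M_d$ the complex $d\times d$ matrices) given by $$T(X)=\bigl(1+(n-1)k\bigr)\,\mathrm{tr}[X]\,\mathbb 1-\sum_{i=1}^n\mathrm{tr}_i[X]\otimes\mathbb 1 ,$$ where $\mathrm{tr}_i[X]\otimes\mathbb 1$ is the partial trace of $X$ over the $i$-th tensor factor, with the traced-out factor replaced by an identity. Then $W_k$ is the Choi matrix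 of $T$, that is, $(T\otimes\mathrm{id})(|\Omega\rangle\langle\Omega|)=W_k$, and $T$ is $k$-positive. -/

import Mathlib

open scoped Matrix Kronecker ComplexOrder

namespace SchmidtWitness

section General

variable {α β : Type*}

/-- The rank-one operator `|ψ⟩⟨ψ|`. -/
def ketBra (ψ : α → ℂ) : Matrix α α ℂ := Matrix.vecMulVec ψ (star ψ)

/-- The number `⟨ψ, W ψ⟩`. -/
def expectation [Fintype α] (W : Matrix α α ℂ) (ψ : α → ℂ) : ℂ := star ψ ⬝ᵥ (W *ᵥ ψ)

/-- Partial trace over the first tensor factor: `tr_A[M]_{ij} = ∑ s, M_{(s,i),(s,j)}`. -/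
def traceFst [Fintype α] (M : Matrix (α × β) (α × β) ℂ) : Matrix β β ℂ :=
  Matrix.of fun i j => ∑ s, M (s, i) (s, j)

/-- Partial trace over the second tensor factor: `tr_B[M]_{ij} = ∑ s, M_{(i,s),(j,s)}`. -/
def traceSnd [Fintype β] (M : Matrix (α × β) (α × β) ℂ) : Matrix α α ℂ :=
  Matrix.of fun i j => ∑ s, M (i, s) (j, s)

/-- The Schmidt rank of `ψ ∈ ℂ^α ⊗ ℂ^β`: the rank of the partial trace of `|ψ⟩⟨ψ|`. -/
noncomputable def schmidtRank [Fintype α] [Fintype β] (ψ : α × β → ℂ) : ℕ := (traceSnd (ketBra ψ)).rank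

/-- `W` is a Schmidt-number witness of class `r`: it is Hermitian, `⟨ψ, W ψ⟩ ≥ 0` for all `ψ` of
Schmidt rank at most `r - 1`, and `⟨φ, W φ⟩ < 0` for at least one `φ` of Schmidt rank `r`. -/
def IsSchmidtNumberWitness [Fintype α] [Fintype β] (r : ℕ)
    (W : Matrix (α × β) (α × β) ℂ) : Prop :=
  W.IsHermitian ∧
  (∀ ψ : α × β → ℂ, schmidtRank ψ < r → 0 ≤ expectation W ψ) ∧
  ∃ φ : α × β → ℂ, schmidtRank φ = r ∧ expectation W φ < 0

/-- The map `T ⊗ id` on matrices over `ℂ^α ⊗ ℂ^γ`, acting on the `γ`-blocks through `T`. -/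
def tensorId (T : Matrix α α ℂ →ₗ[ℂ] Matrix β β ℂ) (γ : Type*)
    (X : Matrix (α × γ) (α × γ) ℂ) : Matrix (β × γ) (β × γ) ℂ :=
  Matrix.of fun p q => T (Matrix.of fun a b => X (a, p.2) (b, q.2)) p.1 q.1

/-- `T` is `k`-positive: `T ⊗ id_k` maps positive semidefinite matrices to such matrices. -/
def IsKPositive (k : ℕ) (T : Matrix α α ℂ →ₗ[ℂ] Matrix β β ℂ) : Prop :=
  ∀ X : Matrix (α × Fin k) (α × Fin k) ℂ, X.PosSemidef → (tensorId T (Fin k) X).PosSemidef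

/-- The (unnormalized) maximally entangled vector `|Ω⟩ = ∑ s, |s⟩ ⊗ |s⟩`. -/
def maxEnt (α : Type*) [DecidableEq α] : α × α → ℂ := fun p => if p.1 = p.2 then 1 else 0

/-- The Choi matrix `(T ⊗ id)(|Ω⟩⟨Ω|)`. -/
def choi [DecidableEq α] (T : Matrix α α ℂ →ₗ[ℂ] Matrix β β ℂ) : Matrix (β × α) (β × α) ℂ :=
  tensorId T α (ketBra (maxEnt α))

end General

/-- The index set of the product basis of `(ℂ^d)^{⊗n}`. -/
abbrev Idx (n d : ℕ) : Type := Fin n → Fin d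

section Multipartite

variable {n d : ℕ}

/-- The tensor product `⨂ j, M j` of operators `M j` on `ℂ^d ⊗ ℂ^d` (the factors `A_j B_j`), as an
operator on `(ℂ^d)^{⊗n} ⊗ (ℂ^d)^{⊗n}` (all factors `A_j` first, then all `B_j`). -/
def tensorAB (M : Fin n → Matrix (Fin d × Fin d) (Fin d × Fin d) ℂ) :
    Matrix (Idx n d × Idx n d) (Idx n d × Idx n d) ℂ :=
  Matrix.of fun p q => ∏ j, M j (p.1 j, p.2 j) (q.1 j, q.2 j)

/-- `ω_(i)`: the identity on `A_i B_i`, tensored with `|Ω_j⟩⟨Ω_j|` on `A_j B_j` for `j ≠ i`. -/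
def omegaOp (i : Fin n) : Matrix (Idx n d × Idx n d) (Idx n d × Idx n d) ℂ :=
  tensorAB fun j => if j = i then 1 else ketBra (maxEnt (Fin d))

/-- `W_k = (1 + (n - 1) k) 1 - ∑ i, ω_(i)`. -/
noncomputable def witnessOp (n d k : ℕ) : Matrix (Idx n d × Idx n d) (Idx n d × Idx n d) ℂ :=
  (1 + ((n : ℂ) - 1) * k) • 1 - ∑ i, omegaOp i

/-- `tr_i[X]`: the partial trace over the `i`-th tensor factor, an operator on the remaining ones. -/
def traceAt (i : Fin n) (X : Matrix (Idx n d) (Idx n d) ℂ) :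
    Matrix ({j // j ≠ i} → Fin d) ({j // j ≠ i} → Fin d) ℂ :=
  traceFst (X.reindex (Equiv.funSplitAt i (Fin d)) (Equiv.funSplitAt i (Fin d)))

/-- `Y ⊗ 1` for an operator `Y` on all tensor factors but the `i`-th, with the identity placed on
the `i`-th factor. -/
def insertOneAt (i : Fin n) (Y : Matrix ({j // j ≠ i} → Fin d) ({j // j ≠ i} → Fin d) ℂ) :
    Matrix (Idx n d) (Idx n d) ℂ :=
  ((1 : Matrix (Fin d) (Fin d) ℂ) ⊗ₖ Y).reindex
    (Equiv.funSplitAt i (Fin d)).symm (Equiv.funSplitAt i (Fin d)).symm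

/-- `T(X) = (1 + (n - 1) k) tr(X) 1 - ∑ i, tr_i[X] ⊗ 1`, a linear map on matrices. -/
noncomputable def reductionMap (n d k : ℕ) :
    Matrix (Idx n d) (Idx n d) ℂ →ₗ[ℂ] Matrix (Idx n d) (Idx n d) ℂ where
  toFun X := ((1 + ((n : ℂ) - 1) * k) * X.trace) • 1 - ∑ i, insertOneAt i (traceAt i X)
  map_add' X Y := by
    ext a b
    simp [insertOneAt, traceAt, traceFst, Matrix.sum_apply, Finset.sum_add_distrib, mul_add,
      add_mul]
    ring
  map_smul' c X := by
    ext a b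
    simp only [insertOneAt, traceAt, traceFst, Matrix.sum_apply, Matrix.sub_apply,
      Matrix.smul_apply, Matrix.trace_smul, Matrix.reindex_apply, Matrix.submatrix_apply,
      Matrix.kroneckerMap_apply, Matrix.of_apply, smul_eq_mul, RingHom.id_apply, mul_sub,
      Finset.mul_sum]
    congr 1
    · ring
    · refine Finset.sum_congr rfl fun i _ => Finset.sum_congr rfl fun s _ => ?_
      ring

end Multipartite

end SchmidtWitness

/-! Read `ψ` as a matrix `C` of rank `r`, so that `‖ψ‖² = tr(Cᴴ C)`, and let `P` be the orthogonal
projection with `C P = C` and `tr P = r`. On two copies of the registers, put `w = C ⊗ P`. The group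
`(ℤ/2)^(1+n)` acts on `w` by commuting swaps `U_g`: one of the column registers, one for each row
factor.

With `g_i` swapping the columns and every row factor except the `i`-th, `⟨w, U_{g_i} w⟩ = ⟨ψ, ω_(i)
ψ⟩` because `C Pᴴ = C`; also `‖w‖² = r ‖ψ‖²`. Since `1 - U_g` and `1 - U_h` are commuting positive
operators, correlations satisfy `c(g) + c(h) ≤ c(0) + c(g + h)`. Iterating gives `∑ c(g_i) ≤ (n - 1)
r ‖ψ‖² + c(∑ g_i)`. The last term is at most `‖ψ‖²`: by parity, `∑ g_i` swaps either only the
columns or all row factors (`sum_expectation_omegaOp_re_le`).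

Sharpness comes from a diagonal vector whose terms differ in a single tensor factor. Finally,
`k`-positivity reduces to rank-one inputs, where only expectations of the Choi matrix in vectors of
Schmidt rank at most `k` occur. -/

namespace SchmidtWitness

/-! ### Correlations under commuting involutions -/

section Correlation

variable {J G ι : Type*} [Fintype J] [AddCommGroup G]

/-- The real part of `⟨w, U_g w⟩`, where `U_g` permutes coordinates through `ρ g`. -/
def correlation (ρ : G → J → J) (w : J → ℂ) (g : G) : ℝ :=
  (∑ x, star (w x) * w (ρ g x)).re

/-- Expanding `‖(1 - U_g)(1 - U_h) w‖² ≥ 0` yields four times the difference of the two sides. -/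
theorem correlation_add_le (ρ : G → J → J) (h_zero : ∀ x, ρ 0 x = x)
    (h_add : ∀ g h x, ρ (g + h) x = ρ g (ρ h x)) (h_two : ∀ g : G, g + g = 0)
    (w : J → ℂ) (g h : G) :
    correlation ρ w g + correlation ρ w h ≤ correlation ρ w 0 + correlation ρ w (g + h) := by
  -- Each `ρ k` is its own inverse, so reindexing by it moves it to the other side.
  have key : ∀ k l : G, (∑ x, star (w (ρ k x)) * w (ρ l x)).re = correlation ρ w (l + k) := by
    intro k l
    have hk : Function.Involutive (ρ k) := fun x => by rw [← h_add, h_two, h_zero]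
    unfold correlation
    congr 1
    refine Fintype.sum_equiv hk.toPerm _ _ fun x => ?_
    simp [h_add, hk x]
  have h0 : 0 ≤ (∑ x, star (w (ρ 0 x) - w (ρ g x) - w (ρ h x) + w (ρ (g + h) x)) *
      (w (ρ 0 x) - w (ρ g x) - w (ρ h x) + w (ρ (g + h) x))).re := by
    have : 0 ≤ ∑ x, star (w (ρ 0 x) - w (ρ g x) - w (ρ h x) + w (ρ (g + h) x)) *
      (w (ρ 0 x) - w (ρ g x) - w (ρ h x) + w (ρ (g + h) x)) :=
      Finset.sum_nonneg fun x _ => star_mul_self_nonneg _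
    exact (Complex.le_def.1 this).1
  have e1 : g + h + g = h := by rw [add_right_comm, h_two, zero_add]
  have e2 : g + h + h = g := by rw [add_assoc, h_two, add_zero]
  have e3 : g + (g + h) = h := by rw [← add_assoc, h_two, zero_add]
  have e4 : h + (g + h) = g := by rw [add_comm g h, ← add_assoc, h_two, zero_add]
  simp only [star_add, star_sub, add_mul, sub_mul, mul_add, mul_sub, Finset.sum_add_distrib,
    Finset.sum_sub_distrib, Complex.add_re, Complex.sub_re, key, h_two, add_zero, zero_add,
    e1, e2, e3, e4, add_comm h g] at h0
  linarith

theorem sum_correlation_le (ρ : G → J → J) (h_zero : ∀ x, ρ 0 x = x)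
    (h_add : ∀ g h x, ρ (g + h) x = ρ g (ρ h x)) (h_two : ∀ g : G, g + g = 0)
    (w : J → ℂ) (g : ι → G) (s : Finset ι) :
    ∑ i ∈ s, correlation ρ w (g i) ≤
      ((s.card : ℝ) - 1) * correlation ρ w 0 + correlation ρ w (∑ i ∈ s, g i) := by
  classical
  induction s using Finset.induction_on with
  | empty => simp
  | insert i s hi ih =>
    have := correlation_add_le ρ h_zero h_add h_two w (g i) (∑ j ∈ s, g j)
    rw [Finset.sum_insert hi, Finset.sum_insert hi, Finset.card_insert_of_notMem hi]
    push_cast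
    linarith

end Correlation

/-- Diagonalize `Cᴴ C` and replace every nonzero eigenvalue by `1`; the trace then counts the
nonzero eigenvalues. -/
theorem exists_rowSpace_projection {ι : Type*} [Fintype ι] [DecidableEq ι] (C : Matrix ι ι ℂ) :
    ∃ P : Matrix ι ι ℂ, Pᴴ = P ∧ P * P = P ∧ C * P = C ∧ P.trace = C.rank := by
  have hH := Matrix.isHermitian_conjTranspose_mul_self C
  set U : Matrix ι ι ℂ := (hH.eigenvectorUnitary : Matrix ι ι ℂ) with hU
  have hUU : Uᴴ * U = 1 := Unitary.coe_star_mul_self hH.eigenvectorUnitary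
  have hspec : Cᴴ * C = U * Matrix.diagonal (RCLike.ofReal ∘ hH.eigenvalues) * Uᴴ := by
    conv_lhs => rw [hH.spectral_theorem, Unitary.conjStarAlgAut_apply]
    rfl
  set D : Matrix ι ι ℂ := Matrix.diagonal fun i => if hH.eigenvalues i = 0 then 0 else 1 with hD
  have hDD : D * D = D := by simp [hD, Matrix.diagonal_mul_diagonal]
  have hDH : Dᴴ = D := by
    rw [hD, Matrix.diagonal_conjTranspose]
    congr 1
    ext i
    by_cases h : hH.eigenvalues i = 0 <;> simp [h]
  have hLD : Matrix.diagonal (RCLike.ofReal ∘ hH.eigenvalues) * D =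
      (Matrix.diagonal (RCLike.ofReal ∘ hH.eigenvalues) : Matrix ι ι ℂ) := by
    rw [hD, Matrix.diagonal_mul_diagonal]
    congr 1
    ext i
    by_cases h : hH.eigenvalues i = 0 <;> simp [h]
  have hPP : U * D * Uᴴ * (U * D * Uᴴ) = U * D * Uᴴ := by
    calc U * D * Uᴴ * (U * D * Uᴴ) = U * D * (Uᴴ * U) * D * Uᴴ := by simp only [Matrix.mul_assoc]
      _ = U * (D * D) * Uᴴ := by rw [hUU, Matrix.mul_one, Matrix.mul_assoc U]
      _ = _ := by rw [hDD]
  have hHP : Cᴴ * C * (U * D * Uᴴ) = Cᴴ * C := by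
    rw [hspec]
    calc _ = U * Matrix.diagonal (RCLike.ofReal ∘ hH.eigenvalues) * (Uᴴ * U) * D * Uᴴ := by
          simp only [Matrix.mul_assoc]
      _ = U * (Matrix.diagonal (RCLike.ofReal ∘ hH.eigenvalues) * D) * Uᴴ := by
          rw [hUU, Matrix.mul_one, Matrix.mul_assoc U]
      _ = _ := by rw [hLD]
  refine ⟨U * D * Uᴴ, ?_, hPP, ?_, ?_⟩
  · simp [Matrix.conjTranspose_mul, hDH, Matrix.mul_assoc]
  · have h : Cᴴ * C * (U * D * Uᴴ - 1) = 0 := by rw [Matrix.mul_sub, hHP]; simp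
    rw [Matrix.conjTranspose_mul_self_mul_eq_zero, Matrix.mul_sub, Matrix.mul_one, sub_eq_zero] at h
    exact h
  · rw [Matrix.trace_mul_comm, ← Matrix.mul_assoc, hUU, Matrix.one_mul,
      ← Matrix.rank_conjTranspose_mul_self, hH.rank_eq_card_non_zero_eigs, hD,
      Matrix.trace_diagonal, Fintype.card_subtype, Finset.sum_ite]
    simp

/-! ### Swaps of the doubled registers -/

section Swaps

/-- Exchange the two components if `e = 1`. -/
def condSwap {α : Type*} (e : ZMod 2) (p : α × α) : α × α := if e = 0 then p else p.swap

theorem condSwap_zero {α : Type*} (p : α × α) : condSwap 0 p = p := by simp [condSwap]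

theorem condSwap_one {α : Type*} (p : α × α) : condSwap 1 p = p.swap := by simp [condSwap]

theorem condSwap_add {α : Type*} (e f : ZMod 2) (p : α × α) :
    condSwap (e + f) p = condSwap e (condSwap f p) := by
  have h : (1 : ZMod 2) + 1 = 0 := by decide
  have h01 : ∀ e : ZMod 2, e = 0 ∨ e = 1 := by decide
  rcases h01 e with rfl | rfl <;> rcases h01 f with rfl | rfl <;> simp [condSwap, h]

variable {α : Type*} {n d : ℕ}

/-- Two registers of each kind: exchange the `α`-registers according to `g.1`, and the tensor
factors of the multipartite registers according to `g.2`. -/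
def registerSwap (g : ZMod 2 × (Fin n → ZMod 2)) (x : (α × α) × (Idx n d × Idx n d)) :
    (α × α) × (Idx n d × Idx n d) :=
  (condSwap g.1 x.1, fun j => (condSwap (g.2 j) (x.2.1 j, x.2.2 j)).1,
    fun j => (condSwap (g.2 j) (x.2.1 j, x.2.2 j)).2)

theorem registerSwap_zero (x : (α × α) × (Idx n d × Idx n d)) : registerSwap 0 x = x := by
  simp [registerSwap, condSwap_zero]

theorem registerSwap_add (g h : ZMod 2 × (Fin n → ZMod 2)) (x : (α × α) × (Idx n d × Idx n d)) :
    registerSwap (g + h) x = registerSwap g (registerSwap h x) := by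
  simp [registerSwap, condSwap_add]

/-- The product vector of two matrices, with the column indices in the first slot. -/
def registerVec (C P : Matrix (Idx n d) α ℂ) (x : (α × α) × (Idx n d × Idx n d)) : ℂ :=
  C x.2.1 x.1.1 * P x.2.2 x.1.2

end Swaps

/-! ### Values of the correlations and the main inequality -/

section Values

variable {α : Type*} [Fintype α] {n d : ℕ}

theorem sum_registerVec_zero (C P : Matrix (Idx n d) α ℂ) :
    ∑ x, star (registerVec C P x) * registerVec C P (registerSwap 0 x) =
      (Cᴴ * C).trace * (Pᴴ * P).trace := by
  simp only [registerSwap_zero, registerVec, Fintype.sum_prod_type, Matrix.trace, Matrix.diag_apply,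
    Matrix.mul_apply, Matrix.conjTranspose_apply, Finset.sum_mul_sum]
  refine Finset.sum_congr rfl fun s _ => Finset.sum_congr rfl fun t _ =>
    Finset.sum_congr rfl fun a _ => Finset.sum_congr rfl fun a' _ => ?_
  rw [star_mul']
  ring

theorem sum_registerVec_swap_fst (C P : Matrix (Idx n d) α ℂ) :
    ∑ x, star (registerVec C P x) * registerVec C P (registerSwap (1, 0) x) =
      (Cᴴ * C * (Pᴴ * P)).trace := by
  simp only [registerSwap, registerVec, Fintype.sum_prod_type, Matrix.trace, Matrix.diag_apply,
    Matrix.mul_apply, Matrix.conjTranspose_apply, Finset.sum_mul_sum, condSwap_one, Pi.zero_apply,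
    condSwap_zero, Prod.swap]
  refine Finset.sum_congr rfl fun s _ => Finset.sum_congr rfl fun t _ =>
    Finset.sum_congr rfl fun a _ => Finset.sum_congr rfl fun a' _ => ?_
  rw [star_mul']
  ring

theorem sum_registerVec_swap_snd (C P : Matrix (Idx n d) α ℂ) :
    ∑ x, star (registerVec C P x) * registerVec C P (registerSwap (0, 1) x) =
      (C * Cᴴ * (P * Pᴴ)).trace := by
  rw [Matrix.trace_mul_comm, ← Equiv.sum_comp (Equiv.prodComm _ _)]
  simp only [registerSwap, registerVec, Fintype.sum_prod_type, Matrix.trace, Matrix.diag_apply,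
    Matrix.mul_apply, Matrix.conjTranspose_apply, Finset.sum_mul_sum, condSwap_one, Pi.one_apply,
    condSwap_zero, Prod.swap, Equiv.prodComm_apply]
  refine Finset.sum_congr rfl fun a _ => Finset.sum_congr rfl fun a' _ => ?_
  rw [Finset.sum_comm]
  refine Finset.sum_congr rfl fun s _ => Finset.sum_congr rfl fun t _ => ?_
  rw [star_mul']
  ring

/-- The column swap pairs each `C` with a `P`, so summing over the column indices produces `C * Pᴴ`
twice. -/
theorem sum_registerVec_swap_all_but (C P : Matrix (Idx n d) α ℂ) (i : Fin n) :
    ∑ x, star (registerVec C P x) *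
        registerVec C P (registerSwap (1, 1 - Pi.single i 1) x) =
      ∑ a, ∑ a', star ((C * Pᴴ) a (Function.update a i (a' i))) *
        (C * Pᴴ) (Function.update a' i (a i)) a' := by
  rw [← Equiv.sum_comp (Equiv.prodComm _ _)]
  have h1 : ∀ a a' : Idx n d, (fun j => (condSwap ((1 - Pi.single i 1 : Fin n → ZMod 2) j)
      (a j, a' j)).1) = Function.update a' i (a i) := by
    intro a a'
    ext j
    by_cases h : j = i
    · subst h; simp [condSwap]
    · simp [condSwap, h]
  have h2 : ∀ a a' : Idx n d, (fun j => (condSwap ((1 - Pi.single i 1 : Fin n → ZMod 2) j)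
      (a j, a' j)).2) = Function.update a i (a' i) := by
    intro a a'
    ext j
    by_cases h : j = i
    · subst h; simp [condSwap]
    · simp [condSwap, h]
  simp only [registerSwap, registerVec, Fintype.sum_prod_type, h1, h2,
    Matrix.mul_apply, Matrix.conjTranspose_apply, star_sum, Finset.sum_mul_sum, condSwap_one,
    Prod.swap, Equiv.prodComm_apply]
  refine Finset.sum_congr rfl fun a _ => Finset.sum_congr rfl fun a' _ =>
    Finset.sum_congr rfl fun s _ => Finset.sum_congr rfl fun t _ => ?_
  rw [star_mul', star_mul', star_star]
  ring

/-- Off `i` the maximally entangled factors force `a = b` and `c = a'`; at `i` the identity forces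
`a = c` and `b = a'`. -/
theorem omegaOp_apply (i : Fin n) (a b c a' : Idx n d) :
    omegaOp i (a, b) (c, a') =
      if b = Function.update a i (a' i) then
        if c = Function.update a' i (a i) then 1 else 0 else 0 := by
  rw [← ite_and]
  simp only [omegaOp, tensorAB, Matrix.of_apply]
  split_ifs with h
  · obtain ⟨rfl, rfl⟩ := h
    refine Finset.prod_eq_one fun j _ => ?_
    by_cases h : j = i
    · subst h
      rw [if_pos rfl, Function.update_self, Function.update_self, Matrix.one_apply_eq]
    · simp [h, ketBra, maxEnt, Matrix.vecMulVec_apply]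
  · by_contra h0
    refine h ⟨funext fun j => ?_, funext fun j => ?_⟩ <;>
    · have hj := (Finset.prod_ne_zero_iff.1 h0) j (Finset.mem_univ j)
      by_cases hji : j = i
      · subst hji
        by_contra hne
        simp_all [Matrix.one_apply]
      · simp [hji, ketBra, maxEnt, Matrix.vecMulVec_apply] at hj
        simp [hji, hj]

theorem expectation_omegaOp (i : Fin n) (ψ : Idx n d × Idx n d → ℂ) :
    expectation (omegaOp i) ψ = ∑ a, ∑ a', star (ψ (a, Function.update a i (a' i))) *
      ψ (Function.update a' i (a i), a') := by
  simp only [expectation, dotProduct, Matrix.mulVec, Fintype.sum_prod_type, omegaOp_apply,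
    Finset.mul_sum, Pi.star_apply]
  refine Finset.sum_congr rfl fun a _ => ?_
  trans ∑ b, ∑ a', ∑ c, star (ψ (a, b)) * ((if b = Function.update a i (a' i) then
      if c = Function.update a' i (a i) then 1 else 0 else 0) * ψ (c, a'))
  · exact Finset.sum_congr rfl fun b _ => Finset.sum_comm
  rw [Finset.sum_comm]
  refine Finset.sum_congr rfl fun a' _ => ?_
  rw [Finset.sum_eq_single (Function.update a i (a' i)),
    Finset.sum_eq_single (Function.update a' i (a i))]
  · simp
  · intro c _ hc; simp [hc]
  · simp
  · intro b _ hb; simp [hb]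
  · simp

/-- The difference of the two sides is `‖(1 - P) C‖²`. -/
theorem trace_mul_projection_le {ι : Type*} [Fintype ι] [DecidableEq ι] (C P : Matrix ι ι ℂ)
    (hP : Pᴴ = P) (hPP : P * P = P) : (C * Cᴴ * P).trace.re ≤ (Cᴴ * C).trace.re := by
  have h := (Matrix.posSemidef_conjTranspose_mul_self ((1 - P) * C)).trace_nonneg
  have e : ((1 - P) * C)ᴴ * ((1 - P) * C) = Cᴴ * C - Cᴴ * P * C := by
    have : (1 - P) * (1 - P) = 1 - P := by
      rw [Matrix.mul_sub, Matrix.sub_mul, Matrix.sub_mul, hPP]; simp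
    rw [Matrix.conjTranspose_mul, Matrix.conjTranspose_sub, hP, Matrix.conjTranspose_one,
      Matrix.mul_assoc, ← Matrix.mul_assoc (1 - P), this, Matrix.sub_mul, Matrix.mul_sub]
    simp [Matrix.mul_assoc]
  rw [e, Matrix.trace_sub] at h
  have h' := (Complex.le_def.1 h).1
  rw [Matrix.mul_assoc, Matrix.trace_mul_comm C]
  simpa using h'

theorem sum_expectation_omegaOp_re_le (C : Matrix (Idx n d) (Idx n d) ℂ) :
    ∑ i, (expectation (omegaOp i) fun p => C p.1 p.2).re ≤
      (1 + ((n : ℝ) - 1) * C.rank) * (Cᴴ * C).trace.re := by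
  obtain ⟨P, hP, hPP, hCP, htr⟩ := exists_rowSpace_projection C
  have h2 : ∀ g : ZMod 2 × (Fin n → ZMod 2), g + g = 0 := fun g => by
    have : ∀ e : ZMod 2, e + e = 0 := by decide
    ext <;> simp [this]
  have hmain := sum_correlation_le (registerSwap (α := Idx n d) (n := n) (d := d)) registerSwap_zero
    registerSwap_add h2 (registerVec C P) (fun i : Fin n => (1, 1 - Pi.single i 1)) Finset.univ
  have hω : ∀ i : Fin n, correlation registerSwap (registerVec C P) (1, 1 - Pi.single i 1) =
      (expectation (omegaOp i) fun p => C p.1 p.2).re := fun i => by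
    rw [correlation, sum_registerVec_swap_all_but, expectation_omegaOp, hP, hCP]
  have h0 : correlation registerSwap (registerVec C P) 0 = C.rank * (Cᴴ * C).trace.re := by
    rw [correlation, sum_registerVec_zero, hP, hPP, htr, mul_comm, ← Complex.ofReal_natCast,
      Complex.re_ofReal_mul]
  have hs : correlation registerSwap (registerVec C P)
      (∑ i : Fin n, ((1 : ZMod 2), (1 - Pi.single i 1 : Fin n → ZMod 2))) ≤
        (Cᴴ * C).trace.re := by
    have hsum : (∑ i : Fin n, ((1 : ZMod 2), (1 - Pi.single i 1 : Fin n → ZMod 2))) =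
        ((n : ZMod 2), ((n : Fin n → ZMod 2) - 1)) := by
      ext j
      · simp [Prod.fst_sum]
      · simp [Prod.snd_sum, Finset.sum_pi_single]
    rw [hsum]
    have h01 : ∀ e : ZMod 2, e = 0 ∨ e = 1 := by decide
    -- For even `n` all row factors are swapped and the columns are not; for odd `n` only the
    -- columns are.
    rcases h01 n with h | h
    · have : ((n : Fin n → ZMod 2) - 1) = 1 := by
        ext j; simp [h]
      rw [this, h, correlation, sum_registerVec_swap_snd, hP, hPP]
      exact trace_mul_projection_le C P hP hPP
    · have : ((n : Fin n → ZMod 2) - 1) = 0 := by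
        ext j; simp [h]
      rw [this, h, correlation, sum_registerVec_swap_fst, hP, hPP, Matrix.mul_assoc, hCP]
  simp only [hω, h0, Finset.card_univ, Fintype.card_fin] at hmain
  linarith

end Values

/-! ### Choi matrices and `k`-positivity -/

section Choi

variable {α β γ : Type*}

theorem choi_apply [DecidableEq α] (T : Matrix α α ℂ →ₗ[ℂ] Matrix β β ℂ) (b b' : β) (a a' : α) :
    choi T (b, a) (b', a') = T (Matrix.single a a' 1) b b' := by
  unfold choi tensorId
  rw [Matrix.of_apply]
  have : (Matrix.of fun s t => ketBra (maxEnt α) (s, a) (t, a')) = Matrix.single a a' 1 := by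
    ext s t
    simp only [ketBra, maxEnt, Matrix.vecMulVec_apply, Matrix.of_apply, Pi.star_apply,
      Matrix.single_apply]
    by_cases h : a = s <;> by_cases h' : a' = t <;> simp [h, h', Ne.symm]
  exact congrArg (fun M => T M b b') this

theorem apply_eq_sum_choi [Fintype α] [DecidableEq α] (T : Matrix α α ℂ →ₗ[ℂ] Matrix β β ℂ)
    (M : Matrix α α ℂ) (b b' : β) :
    T M b b' = ∑ a, ∑ a', M a a' * choi T (b, a) (b', a') := by
  conv_lhs => rw [Matrix.matrix_eq_sum_single M]
  simp only [map_sum, Matrix.sum_apply, choi_apply]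
  refine Finset.sum_congr rfl fun a _ => Finset.sum_congr rfl fun a' _ => ?_
  rw [← smul_eq_mul, ← Matrix.smul_apply, ← map_smul, Matrix.smul_single]
  simp

/-- The operator `1 ⊗ x†`, with `x ∈ ℂ^α ⊗ ℂ^γ` read as a map from `ℂ^γ` to `ℂ^α`. -/
def oneTensor (β : Type*) [DecidableEq β] (x : α × γ → ℂ) : Matrix (β × α) (β × γ) ℂ :=
  (1 : Matrix β β ℂ) ⊗ₖ Matrix.of fun a c => star (x (a, c))

theorem tensorId_ketBra [Fintype α] [DecidableEq α] [Fintype β] [DecidableEq β]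
    (T : Matrix α α ℂ →ₗ[ℂ] Matrix β β ℂ) (x : α × γ → ℂ) :
    tensorId T γ (ketBra x) = (oneTensor β x)ᴴ * choi T * oneTensor β x := by
  ext ⟨b, c⟩ ⟨b', c'⟩
  simp only [tensorId, Matrix.of_apply, apply_eq_sum_choi, Matrix.mul_apply, oneTensor,
    Matrix.conjTranspose_apply, Matrix.kroneckerMap_apply, Fintype.sum_prod_type, ketBra,
    Matrix.vecMulVec_apply, Pi.star_apply, Matrix.one_apply]
  simp [Finset.sum_mul, apply_ite (starRingEnd ℂ), Finset.sum_ite_irrel]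
  rw [Finset.sum_comm]
  refine Finset.sum_congr rfl fun a _ => Finset.sum_congr rfl fun a' _ => ?_
  ring

theorem schmidtRank_eq_rank [Fintype α] [Fintype β] (ψ : α × β → ℂ) :
    schmidtRank ψ = (Matrix.of fun a b => ψ (a, b)).rank := by
  rw [← Matrix.rank_self_mul_conjTranspose, schmidtRank]
  rfl

/-- The coefficient matrix factors through `ℂ^γ`. -/
theorem schmidtRank_oneTensor_mulVec_le [Fintype α] [Fintype β] [DecidableEq β] [Fintype γ]
    (x : α × γ → ℂ) (y : β × γ → ℂ) :
    schmidtRank (oneTensor β x *ᵥ y) ≤ Fintype.card γ := by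
  have h : (Matrix.of fun b a => (oneTensor β x *ᵥ y) (b, a)) =
      (Matrix.of fun b c => y (b, c)) * (Matrix.of fun c a => star (x (a, c))) := by
    ext b a
    simp [Matrix.mulVec, dotProduct, oneTensor, Fintype.sum_prod_type, Matrix.mul_apply,
      Matrix.one_apply, mul_comm]
  rw [schmidtRank_eq_rank, h]
  exact (Matrix.rank_mul_le_left _ _).trans (Matrix.rank_le_card_width _)

open scoped MatrixOrder in
theorem isKPositive_of_expectation_nonneg [Fintype α] [DecidableEq α] [Fintype β] [DecidableEq β]
    (k : ℕ) (T : Matrix α α ℂ →ₗ[ℂ] Matrix β β ℂ) (hT : (choi T).IsHermitian)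
    (h : ∀ ψ : β × α → ℂ, schmidtRank ψ ≤ k → 0 ≤ expectation (choi T) ψ) :
    IsKPositive k T := by
  have h1 : ∀ x : α × Fin k → ℂ, (tensorId T (Fin k) (ketBra x)).PosSemidef := fun x => by
    rw [tensorId_ketBra]
    refine Matrix.PosSemidef.of_dotProduct_mulVec_nonneg
      (Matrix.isHermitian_conjTranspose_mul_mul _ hT) fun y => ?_
    have := h (oneTensor β x *ᵥ y) ((schmidtRank_oneTensor_mulVec_le x y).trans (by simp))
    rw [expectation, Matrix.star_mulVec, ← Matrix.dotProduct_mulVec, Matrix.mulVec_mulVec,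
      Matrix.mulVec_mulVec] at this
    exact this
  intro X hX
  -- The rows of `B` split `X` into rank-one positive operators.
  obtain ⟨B, rfl⟩ := CStarAlgebra.nonneg_iff_eq_star_mul_self.1 hX.nonneg
  rw [Matrix.star_eq_conjTranspose]
  have h2 : tensorId T (Fin k) (Bᴴ * B) = ∑ m, tensorId T (Fin k) (ketBra (star (B m))) := by
    ext p q
    simp only [tensorId, Matrix.of_apply, Matrix.sum_apply]
    rw [← Matrix.sum_apply, ← map_sum]
    have : (Matrix.of fun a b => (Bᴴ * B) (a, p.2) (b, q.2)) =
        ∑ m, Matrix.of fun a b => ketBra (star (B m)) (a, p.2) (b, q.2) := by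
      ext a b
      simp [Matrix.mul_apply, Matrix.sum_apply, ketBra, Matrix.vecMulVec_apply]
    rw [this]
  rw [h2]
  exact Matrix.posSemidef_sum _ fun m _ => h1 _

end Choi

/-! ### Positivity of the witness and its Choi form -/

section Witness

variable {n d : ℕ}

theorem isHermitian_omegaOp (i : Fin n) : (omegaOp (d := d) i).IsHermitian := by
  ext ⟨a, b⟩ ⟨c, a'⟩
  rw [Matrix.conjTranspose_apply, omegaOp, tensorAB, Matrix.of_apply, Matrix.of_apply, star_prod]
  refine Finset.prod_congr rfl fun j _ => ?_
  by_cases h : j = i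
  · simp [h, Matrix.one_apply, eq_comm]
  · simp [h, ketBra, Matrix.vecMulVec_apply, mul_comm]

theorem isHermitian_witnessOp (n d k : ℕ) : (witnessOp n d k).IsHermitian := by
  refine Matrix.IsHermitian.sub ?_ ?_
  · ext p q
    by_cases h : p = q
    · simp [h]
    · simp [h, Ne.symm h]
  · rw [Matrix.IsHermitian, Matrix.conjTranspose_sum]
    exact Finset.sum_congr rfl fun i _ => isHermitian_omegaOp i

theorem expectation_im_eq_zero {ι : Type*} [Fintype ι] {W : Matrix ι ι ℂ} (hW : W.IsHermitian)
    (ψ : ι → ℂ) : (expectation W ψ).im = 0 :=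
  hW.im_star_dotProduct_mulVec_self ψ

theorem expectation_witnessOp (k : ℕ) (ψ : Idx n d × Idx n d → ℂ) :
    expectation (witnessOp n d k) ψ =
      (1 + ((n : ℂ) - 1) * k) * (star ψ ⬝ᵥ ψ) - ∑ i, expectation (omegaOp i) ψ := by
  simp only [expectation, witnessOp, Matrix.sub_mulVec, Matrix.smul_mulVec, Matrix.one_mulVec,
    Matrix.sum_mulVec, dotProduct_sub, dotProduct_smul, dotProduct_sum, smul_eq_mul]

theorem expectation_witnessOp_nonneg (k : ℕ) (hn : 1 ≤ n) (ψ : Idx n d × Idx n d → ℂ)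
    (hψ : schmidtRank ψ ≤ k) : 0 ≤ expectation (witnessOp n d k) ψ := by
  refine Complex.le_def.2 ⟨?_, (expectation_im_eq_zero (isHermitian_witnessOp n d k) ψ).symm⟩
  set C : Matrix (Idx n d) (Idx n d) ℂ := Matrix.of fun a b => ψ (a, b) with hC
  have hnorm : star ψ ⬝ᵥ ψ = (Cᴴ * C).trace := by
    simp only [dotProduct, Matrix.trace, Fintype.sum_prod_type_right, Matrix.diag_apply,
      Matrix.mul_apply]
    rfl
  have h0 := (Complex.le_def.1 (Matrix.posSemidef_conjTranspose_mul_self C).trace_nonneg).1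
  have hmain := sum_expectation_omegaOp_re_le C
  rw [schmidtRank_eq_rank] at hψ
  -- Here `n ≥ 1` is needed: the coefficient must be monotone in the rank.
  have hcoef : 1 + ((n : ℝ) - 1) * C.rank ≤ 1 + ((n : ℝ) - 1) * k := by
    have h1 : (1 : ℝ) ≤ n := by exact_mod_cast hn
    have h2 : (C.rank : ℝ) ≤ k := by exact_mod_cast hψ
    have := mul_le_mul_of_nonneg_left h2 (sub_nonneg.2 h1)
    linarith
  have hc : (1 + ((n : ℂ) - 1) * k) = ((1 + ((n : ℝ) - 1) * k : ℝ) : ℂ) := by push_cast; rfl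
  rw [expectation_witnessOp, hnorm, hc, Complex.sub_re, Complex.re_ofReal_mul, Complex.re_sum]
  have := mul_le_mul_of_nonneg_right hcoef h0
  exact sub_nonneg.2 (hmain.trans this)

theorem _root_.Equiv.funSplitAt_symm_update {ι κ : Type*} [DecidableEq ι] (i : ι)
    (a : ι → κ) (s : κ) :
    (Equiv.funSplitAt i κ).symm (s, ((Equiv.funSplitAt i κ) a).2) = Function.update a i s := by
  ext j
  by_cases h : j = i
  · subst h; simp
  · simp [h]

theorem choi_reductionMap (n d k : ℕ) : choi (reductionMap n d k) = witnessOp n d k := by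
  ext ⟨a, b⟩ ⟨c, a'⟩
  rw [choi_apply]
  simp only [reductionMap, LinearMap.coe_mk, AddHom.coe_mk, witnessOp, Matrix.sub_apply,
    Matrix.smul_apply, Matrix.sum_apply, smul_eq_mul]
  congr 1
  · rw [Matrix.one_apply, Matrix.one_apply, mul_assoc]
    congr 1
    by_cases h : b = a'
    · subst h; by_cases h' : a = c <;> simp [h']
    · simp [h, Matrix.trace_single_eq_of_ne]
  · refine Finset.sum_congr rfl fun i _ => ?_
    simp only [insertOneAt, traceAt, traceFst, Matrix.reindex_apply, Matrix.submatrix_apply,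
      Matrix.kroneckerMap_apply, Matrix.of_apply, Matrix.single_apply, Equiv.symm_symm,
      omegaOp_apply, Equiv.funSplitAt_symm_update]
    simp only [Equiv.funSplitAt_apply, Matrix.one_apply]
    rw [Finset.sum_eq_single (a' i)]
    · have e1 : c = Function.update a' i (a i) ↔ a i = c i ∧ a' = Function.update c i (a' i) := by
        constructor
        · intro h; rw [h]; simp
        · rintro ⟨h1, h2⟩; rw [h2, h1]; simp
      by_cases h1 : b = Function.update a i (a' i) <;>
        simp only [e1, h1, ite_and, if_true, if_false, true_and, false_and, mul_ite, mul_one,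
          mul_zero]
      split_ifs <;> rfl
    · intro s _ hs
      refine if_neg fun h => hs ?_
      rw [h.2]; simp
    · simp

end Witness

/-! ### A vector of Schmidt rank `k + 1` with negative expectation -/

section Diagonal

variable {n d : ℕ}

/-- The vector `∑ a ∈ S, |a⟩ ⊗ |a⟩`. -/
def diagVec {α : Type*} [DecidableEq α] (S : Finset α) : α × α → ℂ :=
  fun p => if p.1 = p.2 ∧ p.2 ∈ S then 1 else 0

theorem schmidtRank_diagVec {α : Type*} [Fintype α] [DecidableEq α] (S : Finset α) :
    schmidtRank (diagVec S) = S.card := by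
  have h : (Matrix.of fun a b => diagVec S (a, b)) =
      Matrix.diagonal fun a => if a ∈ S then (1 : ℂ) else 0 := by
    ext a b
    by_cases h : a = b
    · subst h; simp [diagVec]
    · simp [diagVec, h]
  rw [schmidtRank_eq_rank, h, Matrix.rank_diagonal, Fintype.card_subtype]
  simp

theorem star_dotProduct_diagVec {α : Type*} [Fintype α] [DecidableEq α] (S : Finset α) :
    star (diagVec S) ⬝ᵥ diagVec S = S.card := by
  simp [dotProduct, diagVec, Fintype.sum_prod_type, ite_and]

theorem expectation_omegaOp_diagVec (i : Fin n) (S : Finset (Idx n d)) :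
    expectation (omegaOp i) (diagVec S) = ∑ a ∈ S, ∑ a' ∈ S, if a i = a' i then 1 else 0 := by
  have h : ∀ a a' : Idx n d, star (diagVec S (a, Function.update a i (a' i))) *
      diagVec S (Function.update a' i (a i), a') =
        if a ∈ S then if a' ∈ S then if a i = a' i then 1 else 0 else 0 else 0 := by
    intro a a'
    by_cases h : a i = a' i
    · have h1 : Function.update a i (a' i) = a := by rw [← h, Function.update_eq_self]
      have h2 : Function.update a' i (a i) = a' := by rw [h, Function.update_eq_self]
      rw [h1, h2]
      by_cases ha : a ∈ S <;> simp [diagVec, h, ha]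
    · simp [diagVec, h]
  simp only [expectation_omegaOp, h, Finset.sum_ite_irrel, Finset.sum_const_zero,
    Finset.sum_ite_mem, Finset.univ_inter]

theorem exists_expectation_witnessOp_neg (k : ℕ) (hn : 2 ≤ n) (hk : k < d) :
    ∃ φ : Idx n d × Idx n d → ℂ, schmidtRank φ = k + 1 ∧ expectation (witnessOp n d k) φ < 0 := by
  let i₀ : Fin n := ⟨0, by omega⟩
  -- These `k + 1` multi-indices differ only at `i₀`. The expectation of `omegaOp i` counts pairs
  -- agreeing at `i`: `k + 1` of them for `i₀`, and all `(k + 1)²` for every other `i`.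
  let e : Fin (k + 1) → Idx n d := fun c =>
    Function.update (fun _ => ⟨0, by omega⟩) i₀ (Fin.castLE hk c)
  have he₀ : ∀ c, e c i₀ = Fin.castLE hk c := fun c => Function.update_self ..
  have he : ∀ c i, i ≠ i₀ → e c i = ⟨0, by omega⟩ := fun c i hi => Function.update_of_ne hi ..
  have hinj : Function.Injective e := fun c c' h => by
    have := congrFun h i₀
    rw [he₀, he₀] at this
    exact Fin.castLE_injective _ this
  have hcard : (Finset.univ.map ⟨e, hinj⟩).card = k + 1 := by simp
  refine ⟨diagVec (Finset.univ.map ⟨e, hinj⟩), by rw [schmidtRank_diagVec, hcard], ?_⟩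
  have h0 : expectation (omegaOp i₀) (diagVec (Finset.univ.map ⟨e, hinj⟩)) = k + 1 := by
    rw [expectation_omegaOp_diagVec]
    simp only [Finset.sum_map, Function.Embedding.coeFn_mk, he₀, Fin.castLE_inj]
    simp
  have h1 : ∀ i ∈ Finset.univ.erase i₀,
      expectation (omegaOp i) (diagVec (Finset.univ.map ⟨e, hinj⟩)) = (k + 1) * (k + 1) := by
    intro i hi
    rw [expectation_omegaOp_diagVec]
    simp only [Finset.sum_map, Function.Embedding.coeFn_mk, he _ i (Finset.ne_of_mem_erase hi)]
    simp
    ring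
  rw [expectation_witnessOp, star_dotProduct_diagVec, hcard,
    ← Finset.add_sum_erase _ _ (Finset.mem_univ i₀), h0, Finset.sum_congr rfl h1, Finset.sum_const,
    Finset.card_erase_of_mem (Finset.mem_univ _), Finset.card_univ, Fintype.card_fin, nsmul_eq_mul,
    Nat.cast_sub (by omega)]
  -- The total is `-(n - 1)(k + 1)`, negative exactly because `n ≥ 2`.
  have hval : (1 + ((n : ℂ) - 1) * k) * ((k + 1 : ℕ) : ℂ) -
      (k + 1 + ((n : ℂ) - (1 : ℕ)) * ((k + 1) * (k + 1))) =
      ((-(((n : ℝ) - 1) * (k + 1)) : ℝ) : ℂ) := by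
    push_cast
    ring
  rw [hval]
  have h2 : (2 : ℝ) ≤ n := by exact_mod_cast hn
  have : 0 < ((n : ℝ) - 1) * (k + 1) := mul_pos (by linarith) (by positivity)
  exact_mod_cast neg_neg_of_pos this

end Diagonal

end SchmidtWitness

theorem mainTheorem12 (n d k : ℕ) (hn : 1 ≤ n) :
    (2 ≤ n → k < d →
      SchmidtWitness.IsSchmidtNumberWitness (k + 1) (SchmidtWitness.witnessOp n d k)) ∧
    (∀ ψ : SchmidtWitness.Idx n d × SchmidtWitness.Idx n d → ℂ,
      SchmidtWitness.schmidtRank ψ ≤ k →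
        0 ≤ SchmidtWitness.expectation (SchmidtWitness.witnessOp n d k) ψ) ∧
    SchmidtWitness.choi (SchmidtWitness.reductionMap n d k) = SchmidtWitness.witnessOp n d k ∧
    SchmidtWitness.IsKPositive k (SchmidtWitness.reductionMap n d k) := by
  have hpos := fun ψ => SchmidtWitness.expectation_witnessOp_nonneg (d := d) k hn ψ
  have hchoi := SchmidtWitness.choi_reductionMap n d k
  have hherm := SchmidtWitness.isHermitian_witnessOp n d k
  refine ⟨fun hn2 hk => ⟨hherm, fun ψ hψ => hpos ψ (Nat.lt_succ_iff.1 hψ),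
    SchmidtWitness.exists_expectation_witnessOp_neg k hn2 hk⟩, hpos, hchoi, ?_⟩
  exact SchmidtWitness.isKPositive_of_expectation_nonneg k _ (hchoi ▸ hherm) (hchoi ▸ hpos)
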